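/- Let $n\ge 0$. A nested sequence is a chain $\mathbf{I}=\{I_i\}_{i=1}^l$, $l\ge 1$, of subsets $\emptyset\subsetneq I_1\subsetneq I_2\subsetneq\cdots\subsetneq I_l\subsetneq\{1,\ldots,n+1\}$; nested sequences are partially ordered by declaring $\mathbf{I}\le\mathbf{I}'$ if and only if $\mathbf{I}'\subset\mathbf{I}$. Let $P_n$ be an $n$-dimensional permutahedron, that is, a nonempty $n$-dimensional convex polytope together with an isomorphism $\mathbf{I}\mapsto F_{\mathbf{I}}$ from the poset of nested sequences to the poset of nonempty proper faces of $P_n$, ordered by inclusion. (For example, $P_n$ may be the convex hull in $\mathbb{R}^{n+1}$ of all permutations of $(1,2,\ldots,n+1)$, with $F_{\mathbf{I}}$ the set of $x\in P_n$ such that $\sum_{i\in I}x_i=1+2+\cdots+|I|$ for all $I\in\mathbf{I}$.) Let $\Delta_n$ be an $n$-simplex with vertices $p_1,\ldots,p_{n+1}$ and, for a nonempty proper subset $I\subset\{1,\ldots,n+1\}$, let $F_I\subset\partial\Delta_n$ be the face of codimension $|I|$ spanned by the vertices $p_i$ with $i\notin I$, so that $F_I\subset F_J$ if and only if $J\subset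 I$. Let $f:P_n\to\Delta_n$ be a continuous map such that for every nested sequence $\mathbf{I}=\{I_i\}_{i=1}^l$ we have $f(F_{\mathbf{I}})\subset F_{I_l}$, where $I_l$ is the largest subset in $\mathbf{I}$. Then $f$ is surjective. -/

import Mathlib

/-- A nested sequence `∅ ⊊ I₁ ⊊ I₂ ⊊ ⋯ ⊊ I_l ⊊ {1, …, n+1}` with `l ≥ 1`, recorded as the set
`{I₁, …, I_l}`: a nonempty finite chain of nonempty proper subsets of an `(n+1)`-element set. -/
@[ext]
structure NestedSeq (n : ℕ) where
  sets : Finset (Finset (Fin (n + 1)))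
  nonempty : sets.Nonempty
  chain : ∀ I ∈ sets, ∀ J ∈ sets, I ⊆ J ∨ J ⊆ I
  ne_empty : ∀ I ∈ sets, I ≠ ∅
  ne_univ : ∀ I ∈ sets, I ≠ Finset.univ

namespace NestedSeq

variable {n : ℕ}

/-- The order on nested sequences: `𝐈 ≤ 𝐉` if and only if `𝐉 ⊆ 𝐈`. -/
instance : PartialOrder (NestedSeq n) where
  le I J := J.sets ⊆ I.sets
  le_refl _ := Finset.Subset.refl _
  le_trans _ _ _ h₁ h₂ := Finset.Subset.trans h₂ h₁
  le_antisymm _ _ h₁ h₂ := NestedSeq.ext (Finset.Subset.antisymm h₂ h₁)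

/-- The largest subset `I_l` of a nested sequence (the union of a chain is its largest member). -/
def largest (I : NestedSeq n) : Finset (Fin (n + 1)) := I.sets.sup id

theorem largest_mem (I : NestedSeq n) : I.largest ∈ I.sets := by
  have hd : ∀ s : Finset (Finset (Fin (n + 1))), s.Nonempty →
      (∀ I ∈ s, ∀ J ∈ s, I ⊆ J ∨ J ⊆ I) → s.sup id ∈ s := by
    intro s hs hc
    obtain ⟨M, hM, hmax⟩ := s.exists_max_image Finset.card hs
    have : s.sup id = M := by
      apply le_antisymm
      · refine Finset.sup_le fun J hJ => ?_
        rcases hc J hJ M hM with h | h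
        · exact h
        · exact (Finset.eq_of_subset_of_card_le h (hmax J hJ)).ge
      · exact Finset.le_sup (f := id) hM
    rw [this]; exact hM
  exact hd _ I.nonempty I.chain

theorem subset_largest (I : NestedSeq n) {J : Finset (Fin (n + 1))} (hJ : J ∈ I.sets) : J ⊆ I.largest :=
  Finset.le_sup (f := id) hJ

end NestedSeq

/-- The nonempty proper faces of a convex polytope `P` (the nonempty subsets, different from `P`,
on which some linear functional attains its maximum over `P`), ordered by inclusion. -/
abbrev ProperFace {E : Type*} [NormedAddCommGroup E] [NormedSpace ℝ E] (P : Set E) : Type _ :=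
  {F : Set E // IsExposed ℝ P F ∧ F.Nonempty ∧ F ≠ P}

/-- An `n`-dimensional permutahedron in `E`: an `n`-dimensional convex polytope together with a
labelling of its nonempty proper faces by nested sequences which is an isomorphism of posets. -/
structure Permutahedron (n : ℕ) (E : Type*) [NormedAddCommGroup E] [NormedSpace ℝ E] where
  carrier : Set E
  isPolytope : ∃ s : Set E, s.Finite ∧ carrier = convexHull ℝ s
  nonempty : carrier.Nonempty
  finrank_eq : Module.finrank ℝ (vectorSpan ℝ carrier) = n
  labelling : NestedSeq n ≃o ProperFace carrier

/-- The face `F_𝐈` of a permutahedron labelled by the nested sequence `𝐈`. -/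
def Permutahedron.face {n : ℕ} {E : Type*} [NormedAddCommGroup E] [NormedSpace ℝ E]
    (P : Permutahedron n E) (I : NestedSeq n) : Set E :=
  (P.labelling I : Set E)

/-- The `n`-simplex with given (affinely independent) vertices. -/
def simplexBody {n : ℕ} {V : Type*} [NormedAddCommGroup V] [NormedSpace ℝ V]
    (s : Affine.Simplex ℝ V n) : Set V :=
  convexHull ℝ (Set.range s.points)

/-- The face `F_I` of an `n`-simplex: the intersection of the facets with labels in `I`, where the
`i`-th facet is the one opposite to the `i`-th vertex. It has codimension `|I|`, and its vertices
are those with labels outside `I`. -/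
def simplexFace {n : ℕ} {V : Type*} [NormedAddCommGroup V] [NormedSpace ℝ V]
    (s : Affine.Simplex ℝ V n) (I : Finset (Fin (n + 1))) : Set V :=
  convexHull ℝ (s.points '' {i | i ∉ I})

/-! The rest of this file constructs the standard permutahedron, the convex hull of all
permutations of `(1, 2, …, n+1)`, as an example of the structure `Permutahedron`. -/

namespace StdPermutahedron

variable {n : ℕ}

/-- The vertex of the standard permutahedron given by a permutation. -/
def vert (σ : Equiv.Perm (Fin (n + 1))) : Fin (n + 1) → ℝ := fun i => ((σ i : ℕ) : ℝ) + 1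

/-- The convex hull of all permutations of `(1, 2, …, n+1)` in `ℝ^(n+1)`. -/
def body (n : ℕ) : Set (Fin (n + 1) → ℝ) := convexHull ℝ (Set.range vert)

/-- The minimum `1 + 2 + ⋯ + |I|` of the coordinate sum over `I` on the standard permutahedron. -/
noncomputable def bd (I : Finset (Fin (n + 1))) : ℝ := (I.card : ℝ) * ((I.card : ℝ) + 1) / 2

/-- The points of the standard permutahedron where, for every `I` in the given collection, the
coordinate sum over `I` is minimal. -/
def faceSet (C : Finset (Finset (Fin (n + 1)))) : Set (Fin (n + 1) → ℝ) :=
  {x | x ∈ body n ∧ ∀ I ∈ C, ∑ i ∈ I, x i = bd I}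

theorem vert_mem (σ : Equiv.Perm (Fin (n + 1))) : vert σ ∈ body n :=
  subset_convexHull ℝ _ ⟨σ, rfl⟩

theorem vert_apply (σ : Equiv.Perm (Fin (n + 1))) (i : Fin (n + 1)) :
    vert σ i = ∑ j, if σ j ≤ σ i then (1 : ℝ) else 0 := by
  rw [Equiv.sum_comp σ (fun k => if k ≤ σ i then (1 : ℝ) else 0), Finset.sum_boole]
  have : (Finset.univ.filter fun k => k ≤ σ i) = Finset.Iic (σ i) := by ext; simp
  rw [this, Fin.card_Iic]
  simp [vert]

theorem sum_vert (σ : Equiv.Perm (Fin (n + 1))) (I : Finset (Fin (n + 1))) :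
    ∑ i ∈ I, vert σ i = bd I + ∑ i ∈ I, ∑ j ∈ Iᶜ, if σ j < σ i then (1 : ℝ) else 0 := by
  have h1 : ∀ i ∈ I, vert σ i = (∑ j ∈ I, if σ j ≤ σ i then (1 : ℝ) else 0) +
      ∑ j ∈ Iᶜ, if σ j < σ i then (1 : ℝ) else 0 := by
    intro i hi
    rw [vert_apply, ← Finset.sum_add_sum_compl I]
    congr 1
    refine Finset.sum_congr rfl fun j hj => ?_
    have hne : σ j ≠ σ i := fun h => (Finset.mem_compl.1 hj) (σ.injective h ▸ hi)
    simp only [le_iff_lt_or_eq, hne, or_false]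
  rw [Finset.sum_congr rfl h1, Finset.sum_add_distrib]
  congr 1
  have h2 : (∑ i ∈ I, ∑ j ∈ I, if σ j ≤ σ i then (1 : ℝ) else 0) +
      (∑ i ∈ I, ∑ j ∈ I, if σ j ≤ σ i then (1 : ℝ) else 0) =
      ∑ i ∈ I, ∑ j ∈ I, (1 + if i = j then (1 : ℝ) else 0) := by
    conv_lhs => arg 2; rw [Finset.sum_comm]
    rw [← Finset.sum_add_distrib]
    refine Finset.sum_congr rfl fun i _ => ?_
    rw [← Finset.sum_add_distrib]
    refine Finset.sum_congr rfl fun j _ => ?_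
    by_cases hij : i = j
    · subst hij; simp
    · have hne : σ i ≠ σ j := fun h => hij (σ.injective h)
      rcases lt_or_gt_of_ne hne with h | h
      · simp [hij, h.le, not_le.2 h]
      · simp [hij, h.le, not_le.2 h]
  have h3 : ∑ i ∈ I, ∑ j ∈ I, (1 + if i = j then (1 : ℝ) else 0) =
      (I.card : ℝ) * ((I.card : ℝ) + 1) := by
    have : ∀ i ∈ I, ∑ j ∈ I, (1 + if i = j then (1 : ℝ) else 0) = (I.card : ℝ) + 1 := by
      intro i hi
      rw [Finset.sum_add_distrib]
      simp [hi]
    rw [Finset.sum_congr rfl this]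
    simp [mul_add]
  rw [h3] at h2
  unfold bd
  linarith

theorem bd_le_vert (σ : Equiv.Perm (Fin (n + 1))) (I : Finset (Fin (n + 1))) :
    bd I ≤ ∑ i ∈ I, vert σ i := by
  rw [sum_vert]
  have : 0 ≤ ∑ i ∈ I, ∑ j ∈ Iᶜ, if σ j < σ i then (1 : ℝ) else 0 :=
    Finset.sum_nonneg fun i _ => Finset.sum_nonneg fun j _ => by split_ifs <;> norm_num
  linarith

theorem vert_eq_iff (σ : Equiv.Perm (Fin (n + 1))) (I : Finset (Fin (n + 1))) :
    ∑ i ∈ I, vert σ i = bd I ↔ ∀ i ∈ I, ∀ j ∉ I, ¬ σ j < σ i := by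
  rw [sum_vert, add_eq_left, Finset.sum_eq_zero_iff_of_nonneg
    (fun i _ => Finset.sum_nonneg fun j _ => by split_ifs <;> norm_num)]
  refine forall₂_congr fun i _ => ?_
  rw [Finset.sum_eq_zero_iff_of_nonneg (fun j _ => by split_ifs <;> norm_num)]
  simp

theorem bd_le {x : Fin (n + 1) → ℝ} (hx : x ∈ body n) (I : Finset (Fin (n + 1))) :
    bd I ≤ ∑ i ∈ I, x i := by
  have hconv : Convex ℝ {x : Fin (n + 1) → ℝ | bd I ≤ ∑ i ∈ I, x i} := by
    refine convex_halfSpace_ge (f := fun x : Fin (n + 1) → ℝ => ∑ i ∈ I, x i) ⟨?_, ?_⟩ _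
    · intro x y; simp [Finset.sum_add_distrib]
    · intro c x; simp [Finset.mul_sum]
  exact convexHull_min (by rintro _ ⟨σ, rfl⟩; exact bd_le_vert σ I) hconv hx

theorem sum_univ {x : Fin (n + 1) → ℝ} (hx : x ∈ body n) :
    ∑ i, x i = bd (Finset.univ : Finset (Fin (n + 1))) := by
  have hconv : Convex ℝ {x : Fin (n + 1) → ℝ | ∑ i, x i = bd (Finset.univ : Finset (Fin (n + 1)))} := by
    refine convex_hyperplane (f := fun x : Fin (n + 1) → ℝ => ∑ i, x i) ⟨?_, ?_⟩ _
    · intro x y; simp [Finset.sum_add_distrib]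
    · intro c x; simp [Finset.mul_sum]
  refine convexHull_min ?_ hconv hx
  rintro _ ⟨σ, rfl⟩
  simpa using (vert_eq_iff σ Finset.univ).2 (by simp)

/-- A permutation that sorts the indices by the values of `r`. -/
theorem exists_sort (r : Fin (n + 1) → ℕ) :
    ∃ σ : Equiv.Perm (Fin (n + 1)), ∀ i j, σ i ≤ σ j → r i ≤ r j := by
  refine ⟨(Tuple.sort r)⁻¹, fun i j h => ?_⟩
  simpa using Tuple.monotone_sort r h

/-- The number of members of the collection `C` that do not contain `i`. -/
def rk (C : Finset (Finset (Fin (n + 1)))) (i : Fin (n + 1)) : ℕ := (C.filter fun I => i ∉ I).card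

theorem rk_lt {C : Finset (Finset (Fin (n + 1)))} (hC : ∀ I ∈ C, ∀ J ∈ C, I ⊆ J ∨ J ⊆ I)
    {I : Finset (Fin (n + 1))} (hI : I ∈ C) {i j : Fin (n + 1)} (hi : i ∈ I) (hj : j ∉ I) :
    rk C i < rk C j := by
  apply Finset.card_lt_card
  rw [Finset.ssubset_iff_of_subset]
  · exact ⟨I, by simp [hI, hj], by simp [hi]⟩
  · intro K hK
    rw [Finset.mem_filter] at hK ⊢
    refine ⟨hK.1, fun hjK => ?_⟩
    rcases hC K hK.1 I hI with h | h
    · exact hj (h hjK)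
    · exact hK.2 (h hi)

theorem exists_adapted {C : Finset (Finset (Fin (n + 1)))}
    (hC : ∀ I ∈ C, ∀ J ∈ C, I ⊆ J ∨ J ⊆ I) {J : Finset (Fin (n + 1))} (hJ : J ∉ C)
    (hJ0 : J ≠ ∅) (hJ1 : J ≠ Finset.univ) :
    ∃ σ : Equiv.Perm (Fin (n + 1)), vert σ ∈ faceSet C ∧ ∑ i ∈ J, vert σ i ≠ bd J := by
  obtain ⟨σ, hσ⟩ := exists_sort (fun i => 2 * rk C i + if i ∈ J then 1 else 0)
  refine ⟨σ, ⟨vert_mem σ, fun I hI => ?_⟩, fun h => ?_⟩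
  · rw [vert_eq_iff]
    intro i hi j hj hlt
    have h1 := hσ j i hlt.le
    have h2 := rk_lt hC hI hi hj
    split_ifs at h1 <;> omega
  · rw [vert_eq_iff] at h
    have key : ∀ i ∈ J, ∀ j ∉ J, rk C i < rk C j := by
      intro i hi j hj
      have h1 := hσ i j (not_lt.1 (h i hi j hj))
      simp only [hi, hj, if_true, if_false] at h1
      omega
    obtain ⟨i0, hi0, himax⟩ := J.exists_max_image (rk C) (Finset.nonempty_iff_ne_empty.2 hJ0)
    have hne : (Jᶜ).Nonempty := by
      rw [Finset.nonempty_iff_ne_empty, Ne, Finset.compl_eq_empty_iff]; exact hJ1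
    obtain ⟨j0, hj0, hjmin⟩ := (Jᶜ).exists_min_image (rk C) hne
    have hlt := key i0 hi0 j0 (Finset.mem_compl.1 hj0)
    obtain ⟨I, hI, hI'⟩ := Finset.exists_mem_notMem_of_card_lt_card hlt
    rw [Finset.mem_filter] at hI
    have hi0I : i0 ∈ I := by
      by_contra hcon
      exact hI' (Finset.mem_filter.2 ⟨hI.1, hcon⟩)
    apply hJ
    have : J = I := by
      ext k
      constructor
      · intro hk
        by_contra hkI
        exact absurd (rk_lt hC hI.1 hi0I hkI) (not_lt.2 (himax k hk))
      · intro hk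
        by_contra hkJ
        exact absurd (rk_lt hC hI.1 hk hI.2) (not_lt.2 (hjmin k (Finset.mem_compl.2 hkJ)))
    rw [this]; exact hI.1

theorem faceSet_nonempty {C : Finset (Finset (Fin (n + 1)))}
    (hC : ∀ I ∈ C, ∀ J ∈ C, I ⊆ J ∨ J ⊆ I) : (faceSet C).Nonempty := by
  obtain ⟨σ, hσ⟩ := exists_sort (rk C)
  refine ⟨vert σ, vert_mem σ, fun I hI => ?_⟩
  rw [vert_eq_iff]
  intro i hi j hj hlt
  exact absurd (rk_lt hC hI hi hj) (not_lt.2 (hσ j i hlt.le))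

/-- A functional that is, up to a constant on the polytope, a negative combination of the
coordinate sums over the members of a chain is maximal exactly on the corresponding face. -/
theorem maximizers_eq {C : Finset (Finset (Fin (n + 1)))}
    (hC : ∀ I ∈ C, ∀ J ∈ C, I ⊆ J ∨ J ⊆ I) (c : Finset (Fin (n + 1)) → ℝ) (hc : ∀ I ∈ C, 0 < c I)
    (K : ℝ) (l : (Fin (n + 1) → ℝ) → ℝ)
    (hl : ∀ x ∈ body n, l x = K - ∑ I ∈ C, c I * ∑ i ∈ I, x i) :
    {x | x ∈ body n ∧ ∀ y ∈ body n, l y ≤ l x} = faceSet C := by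
  ext x
  constructor
  · rintro ⟨hx, hmax⟩
    refine ⟨hx, ?_⟩
    obtain ⟨x0, hx0, hx0'⟩ := faceSet_nonempty hC
    have h1 := hmax x0 hx0
    rw [hl x hx, hl x0 hx0] at h1
    have h2 : ∑ I ∈ C, c I * (∑ i ∈ I, x i - bd I) ≤ 0 := by
      have : ∑ I ∈ C, c I * ∑ i ∈ I, x0 i = ∑ I ∈ C, c I * bd I :=
        Finset.sum_congr rfl fun I hI => by rw [hx0' I hI]
      simp only [mul_sub, Finset.sum_sub_distrib]
      linarith
    have h3 : ∀ I ∈ C, 0 ≤ c I * (∑ i ∈ I, x i - bd I) := fun I hI =>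
      mul_nonneg (hc I hI).le (sub_nonneg.2 (bd_le hx I))
    have h4 := (Finset.sum_eq_zero_iff_of_nonneg h3).1 (le_antisymm h2 (Finset.sum_nonneg h3))
    intro I hI
    have := (mul_eq_zero.1 (h4 I hI)).resolve_left (hc I hI).ne'
    linarith
  · rintro ⟨hx, hx'⟩
    refine ⟨hx, fun y hy => ?_⟩
    rw [hl x hx, hl y hy]
    apply sub_le_sub_left
    refine Finset.sum_le_sum fun I hI => ?_
    rw [hx' I hI]
    exact mul_le_mul_of_nonneg_left (bd_le hy I) (hc I hI).le

/-- Every weight vector is a constant minus a positive combination of the indicators of its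
proper sublevel sets. -/
theorem exists_layers (m : ℕ) (a : Fin (n + 1) → ℝ) (hm : (Finset.univ.image a).card ≤ m) :
    ∃ (C : Finset (Finset (Fin (n + 1)))) (c : Finset (Fin (n + 1)) → ℝ) (K : ℝ),
      (∀ I ∈ C, I ≠ ∅ ∧ I ≠ Finset.univ ∧ ∃ t, I = Finset.univ.filter fun i => a i ≤ t) ∧
      (∀ I ∈ C, 0 < c I) ∧ ∀ i, a i = K - ∑ I ∈ C, c I * if i ∈ I then 1 else 0 := by
  induction m generalizing a with
  | zero =>
    have := Finset.card_pos.2 ((Finset.univ_nonempty (α := Fin (n + 1))).image a)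
    omega
  | succ m ih =>
    obtain ⟨k, -, hk⟩ := Finset.univ.exists_max_image a Finset.univ_nonempty
    by_cases hconst : ∀ i, a i = a k
    · exact ⟨∅, 0, a k, by simp, by simp, by simpa using hconst⟩
    push Not at hconst
    obtain ⟨i1, hi1⟩ := hconst
    have hi1' : a i1 < a k := lt_of_le_of_ne (hk i1 (Finset.mem_univ _)) hi1
    set S : Finset (Fin (n + 1)) := Finset.univ.filter fun i => a i < a k with hS
    have hi1S : i1 ∈ S := by simp [hS, hi1']
    obtain ⟨q, hq, hqmax⟩ := S.exists_max_image a ⟨i1, hi1S⟩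
    have hqk : a q < a k := (Finset.mem_filter.1 hq).2
    have hmin : ∀ i, (a i < a k ∧ min (a i) (a q) = a i ∧ i ∈ S) ∨
        (a i = a k ∧ min (a i) (a q) = a q ∧ i ∉ S) := by
      intro i
      rcases lt_or_eq_of_le (hk i (Finset.mem_univ _)) with h | h
      · have hiS : i ∈ S := by simp [hS, h]
        exact Or.inl ⟨h, min_eq_left (hqmax i hiS), hiS⟩
      · exact Or.inr ⟨h, min_eq_right (h ▸ hqk.le), by simp [hS, h]⟩
    have hcard : (Finset.univ.image fun i => min (a i) (a q)).card ≤ m := by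
      have hss : (Finset.univ.image fun i => min (a i) (a q)) ⊂ Finset.univ.image a := by
        rw [Finset.ssubset_iff_of_subset]
        · refine ⟨a k, Finset.mem_image_of_mem _ (Finset.mem_univ _), ?_⟩
          intro h
          obtain ⟨i, -, hi⟩ := Finset.mem_image.1 h
          have := min_le_right (a i) (a q)
          linarith
        · intro y hy
          obtain ⟨i, -, rfl⟩ := Finset.mem_image.1 hy
          rcases min_choice (a i) (a q) with h | h
          · rw [h]; exact Finset.mem_image_of_mem _ (Finset.mem_univ _)
          · rw [h]; exact Finset.mem_image_of_mem _ (Finset.mem_univ _)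
      have := Finset.card_lt_card hss
      omega
    obtain ⟨C, c, K, hC, hc, hK⟩ := ih (fun i => min (a i) (a q)) hcard
    have hlev : ∀ I ∈ C, ∃ t, t < a q ∧ I = Finset.univ.filter fun i => a i ≤ t := by
      intro I hI
      obtain ⟨-, hne, t, ht⟩ := hC I hI
      have htq : t < a q := by
        by_contra hcon
        apply hne
        rw [ht]
        exact Finset.filter_true_of_mem fun i _ => (min_le_right _ _).trans (not_lt.1 hcon)
      refine ⟨t, htq, ?_⟩
      rw [ht]
      ext i
      simp only [Finset.mem_filter, Finset.mem_univ, true_and, min_le_iff]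
      exact or_iff_left (not_le.2 htq)
    have hSC : S ∉ C := by
      intro h
      obtain ⟨t, htq, ht⟩ := hlev S h
      rw [ht] at hq
      exact absurd (Finset.mem_filter.1 hq).2 (not_le.2 htq)
    refine ⟨insert S C, fun I => if I = S then a k - a q else c I, K + (a k - a q), ?_, ?_, ?_⟩
    · intro I hI
      rcases Finset.mem_insert.1 hI with rfl | hI
      · refine ⟨Finset.ne_empty_of_mem hi1S, fun h => ?_, a q, ?_⟩
        · have : k ∈ S := h ▸ Finset.mem_univ k
          exact lt_irrefl _ (Finset.mem_filter.1 this).2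
        · ext i
          simp only [Finset.mem_filter, Finset.mem_univ, true_and]
          constructor
          · intro hi
            exact hqmax i hi
          · intro hi
            rw [hS]; simpa using hi.trans_lt hqk
      · obtain ⟨t, -, ht⟩ := hlev I hI
        exact ⟨(hC I hI).1, (hC I hI).2.1, t, ht⟩
    · intro I hI
      dsimp only
      split_ifs with h
      · linarith
      · exact hc I ((Finset.mem_insert.1 hI).resolve_left h)
    · intro i
      rw [Finset.sum_insert hSC]
      have hsum : ∑ I ∈ C, (if I = S then a k - a q else c I) * (if i ∈ I then (1 : ℝ) else 0) =
          ∑ I ∈ C, c I * if i ∈ I then 1 else 0 := by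
        refine Finset.sum_congr rfl fun I hI => ?_
        rw [if_neg (by rintro rfl; exact hSC hI)]
      beta_reduce
      rw [hsum, if_pos rfl]
      have hKi := hK i
      rcases hmin i with ⟨h1, h2, h3⟩ | ⟨h1, h2, h3⟩
      · rw [if_pos h3]
        linarith
      · rw [if_neg h3]
        linarith

theorem sum_indicator (C : Finset (Finset (Fin (n + 1)))) (c : Finset (Fin (n + 1)) → ℝ) (K : ℝ)
    (x : Fin (n + 1) → ℝ) :
    ∑ i, x i * (K - ∑ I ∈ C, c I * if i ∈ I then 1 else 0) =
      K * ∑ i, x i - ∑ I ∈ C, c I * ∑ i ∈ I, x i := by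
  simp only [mul_sub, Finset.sum_sub_distrib]
  congr 1
  · rw [Finset.mul_sum]; exact Finset.sum_congr rfl fun i _ => mul_comm _ _
  · simp only [Finset.mul_sum]
    rw [Finset.sum_comm]
    refine Finset.sum_congr rfl fun I _ => ?_
    simp [Finset.sum_ite_mem, mul_comm]

theorem faceSet_isExposed {C : Finset (Finset (Fin (n + 1)))}
    (hC : ∀ I ∈ C, ∀ J ∈ C, I ⊆ J ∨ J ⊆ I) : IsExposed ℝ (body n) (faceSet C) := by
  intro _
  refine ⟨-∑ I ∈ C, ∑ i ∈ I, ContinuousLinearMap.proj i, ?_⟩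
  refine (maximizers_eq hC (fun _ => 1) (by simp) 0 _ fun x _ => ?_).symm
  simp

theorem faceSet_ne_body {C : Finset (Finset (Fin (n + 1)))} (h0 : C.Nonempty)
    (hne : ∀ I ∈ C, I ≠ ∅) (hnu : ∀ I ∈ C, I ≠ Finset.univ) : faceSet C ≠ body n := by
  obtain ⟨I, hI⟩ := h0
  intro h
  obtain ⟨σ, -, hσ⟩ := exists_adapted (C := ∅) (by simp) (Finset.notMem_empty I) (hne I hI)
    (hnu I hI)
  have : vert σ ∈ faceSet C := h ▸ vert_mem σ
  exact hσ (this.2 I hI)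

/-- The face of the standard permutahedron labelled by a nested sequence. -/
def toFace (I : NestedSeq n) : ProperFace (body n) :=
  ⟨faceSet I.sets, faceSet_isExposed I.chain, faceSet_nonempty I.chain,
    faceSet_ne_body I.nonempty I.ne_empty I.ne_univ⟩

theorem toFace_le_iff (I J : NestedSeq n) : toFace I ≤ toFace J ↔ I ≤ J := by
  constructor
  · intro h A hA
    by_contra hAI
    obtain ⟨σ, h1, h2⟩ := exists_adapted I.chain hAI (J.ne_empty A hA) (J.ne_univ A hA)
    have h3 : vert σ ∈ faceSet J.sets := h h1
    exact h2 (h3.2 A hA)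
  · intro h x hx
    exact ⟨hx.1, fun A hA => hx.2 A (h hA)⟩

theorem toFace_surjective : Function.Surjective (toFace (n := n)) := by
  rintro ⟨F, hF, hne, hprop⟩
  obtain ⟨l, hl⟩ := hF hne
  obtain ⟨C, c, K, hC, hc, hK⟩ :=
    exists_layers _ (fun i => l (fun j => if i = j then 1 else 0)) le_rfl
  have hl' : ∀ x ∈ body n,
      l x = K * bd (Finset.univ : Finset (Fin (n + 1))) - ∑ I ∈ C, c I * ∑ i ∈ I, x i := by
    intro x hx
    have h1 : l x = ∑ i, x i * l (fun j => if i = j then 1 else 0) := by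
      simpa using LinearMap.pi_apply_eq_sum_univ (l : (Fin (n + 1) → ℝ) →ₗ[ℝ] ℝ) x
    rw [h1, ← sum_univ hx, ← sum_indicator]
    exact Finset.sum_congr rfl fun i _ => by rw [← hK i]
  have hchain : ∀ I ∈ C, ∀ J ∈ C, I ⊆ J ∨ J ⊆ I := by
    intro I hI J hJ
    obtain ⟨-, -, s, rfl⟩ := hC I hI
    obtain ⟨-, -, t, rfl⟩ := hC J hJ
    rcases le_total s t with h | h
    · left
      intro i hi
      simp only [Finset.mem_filter, Finset.mem_univ, true_and] at hi ⊢
      exact hi.trans h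
    · right
      intro i hi
      simp only [Finset.mem_filter, Finset.mem_univ, true_and] at hi ⊢
      exact hi.trans h
  have hFC : F = faceSet C := by
    rw [hl]
    exact maximizers_eq hchain c hc _ l hl'
  have hCne : C.Nonempty := by
    rw [Finset.nonempty_iff_ne_empty]
    rintro rfl
    exact hprop (hFC.trans (by ext x; simp [faceSet]))
  exact ⟨⟨C, hCne, hchain, fun I hI => (hC I hI).1, fun I hI => (hC I hI).2.1⟩,
    Subtype.ext hFC.symm⟩

theorem finrank_body : Module.finrank ℝ (vectorSpan ℝ (body n)) = n := by
  let S : (Fin (n + 1) → ℝ) →ₗ[ℝ] ℝ := ∑ i, LinearMap.proj i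
  have hS : ∀ x, S x = ∑ i, x i := fun x => by simp [S]
  have hspan : vectorSpan ℝ (body n) = LinearMap.ker S := by
    apply le_antisymm
    · rw [vectorSpan, Submodule.span_le]
      rintro _ ⟨x, hx, y, hy, rfl⟩
      simp only [SetLike.mem_coe, LinearMap.mem_ker, hS]
      simp [Finset.sum_sub_distrib, sum_univ hx, sum_univ hy]
    · have hdiff : ∀ i : Fin (n + 1),
          (Pi.single i 1 - Pi.single 0 1 : Fin (n + 1) → ℝ) ∈ vectorSpan ℝ (body n) := by
        intro i
        by_cases hi : i = 0
        · subst hi; simp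
        have h := vsub_mem_vectorSpan ℝ (vert_mem (Equiv.swap i 0)) (vert_mem (Equiv.refl _))
        have h2 := (vectorSpan ℝ (body n)).smul_mem (-(((i : ℕ) : ℝ))⁻¹) h
        have hi0 : ((i : ℕ) : ℝ) ≠ 0 := by
          exact Nat.cast_ne_zero.2 fun h0 => hi (Fin.ext h0)
        convert h2 using 1
        ext j
        by_cases h0 : j = 0
        · subst h0
          have hs : (Pi.single i 1 : Fin (n + 1) → ℝ) 0 = 0 := Pi.single_eq_of_ne (Ne.symm hi) _
          simp only [vert, Pi.sub_apply, Pi.smul_apply, vsub_eq_sub, hs, Pi.single_eq_same,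
            Equiv.swap_apply_right, Equiv.refl_apply, smul_eq_mul, Fin.val_zero, Nat.cast_zero]
          field_simp
          ring
        by_cases hj : j = i
        · subst hj
          simp [vert, h0, hi0]
        · simp [vert, h0, hj, Equiv.swap_apply_of_ne_of_ne hj h0]
      intro x hx
      rw [LinearMap.mem_ker, hS] at hx
      have : x = ∑ i, x i • (Pi.single i 1 - Pi.single 0 1 : Fin (n + 1) → ℝ) := by
        simp only [smul_sub, Finset.sum_sub_distrib, ← Finset.sum_smul, hx, zero_smul, sub_zero]
        exact pi_eq_sum_univ' x
      rw [this]
      exact Submodule.sum_mem _ fun i _ => Submodule.smul_mem _ _ (hdiff i)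
  have hrange : LinearMap.range S = ⊤ := by
    rw [LinearMap.range_eq_top]
    intro t
    exact ⟨Pi.single 0 t, by simp [hS]⟩
  have := LinearMap.finrank_range_add_finrank_ker S
  rw [hrange, finrank_top] at this
  simp at this
  rw [hspan]
  omega

end StdPermutahedron

/-- The standard permutahedron: the convex hull of all permutations of `(1, 2, …, n+1)`, where the
face labelled by `𝐈` is the set of points at which, for all `I ∈ 𝐈`, the sum of the coordinates
with indices in `I` has its minimal value `1 + 2 + ⋯ + |I|`. -/
noncomputable def standardPermutahedron (n : ℕ) : Permutahedron n (Fin (n + 1) → ℝ) where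
  carrier := StdPermutahedron.body n
  isPolytope := ⟨_, Set.finite_range _, rfl⟩
  nonempty := ⟨_, StdPermutahedron.vert_mem 1⟩
  finrank_eq := StdPermutahedron.finrank_body
  labelling := RelIso.ofSurjective
    (OrderEmbedding.ofMapLEIff StdPermutahedron.toFace StdPermutahedron.toFace_le_iff)
    StdPermutahedron.toFace_surjective

/-! The map `f` is precomposed with a continuous `g : Δ_n → P_n` sending a boundary point `x` into a
facet labelled by a single set `J` that contains every `i` with `x i = 0`
(`exists_continuous_from_stdSimplex`). The hypothesis on `f` then says that `f ∘ g` keeps every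
vanishing barycentric coordinate zero. Such a self-map of a simplex is onto
(`stdSimplex_surjective_of_mapsTo_faces`), hence so is `f`.

The map `g` is a weighted mean of one chosen point in each face and one further point of `P_n`. The
weights are such that, at a boundary point, all nested sequences of nonzero weight share the set `J`
of largest gap. The points involved then lie in the convex facet labelled `J`.

Surjectivity of face-preserving self-maps follows from Sperner's lemma (`exists_rainbow`) and
compactness. Sperner's lemma is proved by volume. The integer points with coordinate sum `m` are the
vertices of simplices traced by the cyclic steps `e_{a+1} - e_a`. For a vertex map `L` into the
hyperplane of sum `m`, the signed sum of determinants does not change when the value at one vertex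
with its whole star in the sum is moved (`volSum_update`). Inside the dilated simplex, the labelling
`x ↦ m e_{l x}` can thus be replaced by the identity, for which the sum is nonzero. Some labelled
simplex therefore has nonzero determinant, so it carries all labels. -/

namespace CyclicLattice

open Matrix

variable {n : ℕ}

/-! ### Lattice simplices traced by cyclic steps -/

theorem eq_zero_of_forall_add_one {α : Type*} {g : Fin (n + 1) → α}
    (h : ∀ x, g (x + 1) = g x) (x : Fin (n + 1)) : g x = g 0 := by
  induction x using Fin.induction with
  | zero => rfl
  | succ i ih => rw [← ih, ← Fin.coeSucc_eq_succ, h]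

/-- The step `e_{a+1} - e_a`, with indices taken modulo `n + 1`. -/
def step (a : Fin (n + 1)) : Fin (n + 1) → ℤ := Pi.single (a + 1) 1 - Pi.single a 1

/-- The displacement after the steps with positions before `k`, taken in the order `π`. -/
def path (π : Equiv.Perm (Fin (n + 1))) (k : Fin (n + 1)) : Fin (n + 1) → ℤ :=
  ∑ i ∈ Finset.Iio k, step (π i)

theorem step_apply (a x : Fin (n + 1)) :
    step a x = (if x - 1 = a then 1 else 0) - if x = a then 1 else 0 := by
  simp [step, Pi.single_apply, sub_eq_iff_eq_add]

theorem sum_step (a : Fin (n + 1)) : ∑ x, step a x = 0 := by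
  simp [step, Finset.sum_sub_distrib]

theorem sum_path (π : Equiv.Perm (Fin (n + 1))) (k : Fin (n + 1)) : ∑ x, path π k x = 0 := by
  simp only [path, Finset.sum_apply]
  rw [Finset.sum_comm]
  simp [sum_step]

theorem path_apply (π : Equiv.Perm (Fin (n + 1))) (k x : Fin (n + 1)) :
    path π k x = (if π.symm (x - 1) < k then 1 else 0) - if π.symm x < k then 1 else 0 := by
  simp only [path, Finset.sum_apply, step_apply, Finset.sum_sub_distrib]
  simp only [← Equiv.symm_apply_eq]
  simp

theorem abs_path_sub_le (π : Equiv.Perm (Fin (n + 1))) (j k x : Fin (n + 1)) :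
    |path π j x - path π k x| ≤ 1 := by
  rw [path_apply, path_apply]
  split_ifs <;> first | (norm_num; done) | (exfalso; omega)

/-- If the positions `j < k` gave the same point, the indicator of the entries at positions in `[j,
k)` would be invariant under the cyclic shift, hence constant. It is 1 at `π j` and 0 at `π
(Fin.last n)`. -/
theorem path_injective (π : Equiv.Perm (Fin (n + 1))) : Function.Injective (path π) := by
  have key : ∀ j k : Fin (n + 1), j < k → path π j ≠ path π k := by
    intro j k hjk h
    let g : Fin (n + 1) → ℤ := fun x =>
      (if π.symm x < k then 1 else 0) - if π.symm x < j then 1 else 0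
    have hg : ∀ x, g (x + 1) = g x := by
      intro x
      have := congrFun h (x + 1)
      rw [path_apply, path_apply, add_sub_cancel_right] at this
      simp only [g]
      linarith
    have h1 := eq_zero_of_forall_add_one hg (π j)
    have h2 := eq_zero_of_forall_add_one hg (π (Fin.last n))
    have h3 : ¬ Fin.last n < k := not_lt.2 (Fin.le_last _)
    have h4 : ¬ Fin.last n < j := not_lt.2 (Fin.le_last _)
    simp only [g, Equiv.symm_apply_apply, hjk, lt_irrefl, h3, h4, if_true, if_false] at h1 h2
    omega
  intro j k h
  rcases lt_trichotomy j k with h' | h' | h'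
  · exact absurd h (key _ _ h')
  · exact h'
  · exact absurd h.symm (key _ _ h')

/-- Exchanging two cyclically adjacent steps moves only the vertex between them. For `w = 0` the
last and first steps are exchanged, which translates all vertices other than the base by one common
vector; hence only differences are compared. This is reflection to the neighbour across the facet
opposite `w`. -/
theorem path_swap (π : Equiv.Perm (Fin (n + 1))) {w j k : Fin (n + 1)} (hj : j ≠ w) (hk : k ≠ w) :
    path (π * Equiv.swap (w - 1) w) j - path (π * Equiv.swap (w - 1) w) k =
      path π j - path π k := by
  have hsymm : ∀ y, (π * Equiv.swap (w - 1) w).symm y = Equiv.swap (w - 1) w (π.symm y) := by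
    intro y
    rw [Equiv.symm_apply_eq]
    simp
  have key : ∀ i, ((if Equiv.swap (w - 1) w i < j then (1 : ℤ) else 0) -
      if Equiv.swap (w - 1) w i < k then 1 else 0) =
      (if i < j then 1 else 0) - if i < k then 1 else 0 := by
    intro i
    have hj' : (j : ℕ) ≠ w := fun h => hj (Fin.ext h)
    have hk' : (k : ℕ) ≠ w := fun h => hk (Fin.ext h)
    have hw : ((w : ℕ) = 0 ∧ ((w - 1 : Fin (n + 1)) : ℕ) = n) ∨
        ((w : ℕ) ≠ 0 ∧ ((w - 1 : Fin (n + 1)) : ℕ) = (w : ℕ) - 1) := by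
      by_cases hw : w = 0
      · left; subst hw; simp
      · exact Or.inr ⟨fun h => hw (Fin.ext h), Fin.val_sub_one_of_ne_zero hw⟩
    generalize w - 1 = u at hw ⊢
    have hjn := j.is_lt
    have hkn := k.is_lt
    by_cases hiu : i = u
    · subst hiu
      rw [Equiv.swap_apply_left]
      simp only [Fin.lt_def]
      split_ifs <;> omega
    by_cases hiw : i = w
    · subst hiw
      rw [Equiv.swap_apply_right]
      simp only [Fin.lt_def]
      split_ifs <;> omega
    rw [Equiv.swap_apply_of_ne_of_ne hiu hiw]
  funext x
  simp only [Pi.sub_apply, path_apply, hsymm]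
  have h1 := key (π.symm (x - 1))
  have h2 := key (π.symm x)
  linarith

/-! ### Invariance of the signed volume -/

/-- Cramer's rule writes `A.det • y` as the combination of the rows of `A` with coefficients
`(A.updateRow w y).det`. Taking coordinate sums kills row `k` and leaves a common factor `m`. -/
theorem det_eq_sum_updateRow {A : Matrix (Fin (n + 1)) (Fin (n + 1)) ℝ} {k : Fin (n + 1)} {m : ℝ}
    (hm : m ≠ 0) (hA : ∀ i ≠ k, ∑ j, A i j = m) (hk : ∑ j, A k j = 0) {y : Fin (n + 1) → ℝ}
    (hy : ∑ j, y j = m) :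
    A.det = ∑ w ∈ Finset.univ.erase k, (A.updateRow w y).det := by
  have h1 := mulVec_cramer Aᵀ y
  have h2 : ∑ j, (Aᵀ *ᵥ cramer Aᵀ y) j = ∑ w, (∑ j, A w j) * (A.updateRow w y).det := by
    simp only [mulVec, dotProduct, transpose_apply, cramer_transpose_apply]
    rw [Finset.sum_comm]
    simp only [Finset.sum_mul]
  rw [h1, ← Finset.add_sum_erase Finset.univ (fun w => (∑ j, A w j) * _) (Finset.mem_univ k)] at h2
  simp only [hk, zero_mul, zero_add] at h2
  simp only [Pi.smul_apply, smul_eq_mul, ← Finset.mul_sum, hy, det_transpose] at h2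
  rw [Finset.sum_congr rfl fun w hw => by rw [hA w (Finset.ne_of_mem_erase hw)],
    ← Finset.mul_sum, mul_comm] at h2
  exact mul_left_cancel₀ hm h2

theorem sum_sign_mul_eq_zero {D : Equiv.Perm (Fin (n + 1)) → ℝ} {a b : Fin (n + 1)} (hab : a ≠ b)
    (hD : ∀ π, D (π * Equiv.swap a b) = D π) :
    ∑ π : Equiv.Perm (Fin (n + 1)), ((Equiv.Perm.sign π : ℤ) : ℝ) * D π = 0 := by
  have h := Equiv.sum_comp (Equiv.mulRight (Equiv.swap a b))
    fun π : Equiv.Perm (Fin (n + 1)) => ((Equiv.Perm.sign π : ℤ) : ℝ) * D π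
  simp only [Equiv.coe_mulRight, hD, Equiv.Perm.sign_mul, Equiv.Perm.sign_swap hab] at h
  simp only [mul_neg, mul_one, Units.val_neg, Int.cast_neg, neg_mul, Finset.sum_neg_distrib] at h
  linarith

/-- Expanding along `L v` gives terms in which vertex `w` no longer appears: cones over the facets
through `v`. By `path_swap` the two simplices sharing such a facet give equal terms of opposite
sign. -/
theorem sum_sign_det_star_eq_zero {m : ℝ} (hm : m ≠ 0) {L : (Fin (n + 1) → ℤ) → Fin (n + 1) → ℝ}
    (hL : ∀ x, ∑ i, L x i = m) {δ : Fin (n + 1) → ℝ} (hδ : ∑ i, δ i = 0)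
    (v : Fin (n + 1) → ℤ) (k : Fin (n + 1)) :
    ∑ π : Equiv.Perm (Fin (n + 1)), ((Equiv.Perm.sign π : ℤ) : ℝ) *
      (updateRow (of fun j => L (v - path π k + path π j)) k δ).det = 0 := by
  have h1 : ∀ π : Equiv.Perm (Fin (n + 1)),
      (updateRow (of fun j => L (v - path π k + path π j)) k δ).det =
      ∑ w ∈ Finset.univ.erase k,
        ((updateRow (of fun j => L (v - path π k + path π j)) k δ).updateRow w (L v)).det := by
    intro π
    refine det_eq_sum_updateRow hm (fun i hi => ?_) ?_ (hL v)
    · rw [updateRow_ne hi]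
      exact hL _
    · rw [updateRow_self]
      exact hδ
  simp only [h1, Finset.mul_sum]
  rw [Finset.sum_comm]
  refine Finset.sum_eq_zero fun w hw => ?_
  have hwk : w ≠ k := Finset.ne_of_mem_erase hw
  refine sum_sign_mul_eq_zero (a := w - 1) (b := w) ?_ fun π => ?_
  -- `w - 1 = w` would force `n = 0`, where no `w ≠ k` exists.
  · intro h
    have h10 : (1 : Fin (n + 1)) = 0 := by simpa using h
    cases n with
    | zero => exact hwk (Fin.ext (by omega))
    | succ n => simp at h10
  · congr 1
    ext i j
    by_cases hiw : i = w
    · subst hiw; simp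
    rw [updateRow_ne hiw, updateRow_ne hiw]
    by_cases hik : i = k
    · subst hik; simp
    rw [updateRow_ne hik, updateRow_ne hik, of_apply, of_apply]
    have := path_swap π hiw hwk.symm
    rw [sub_add_eq_add_sub, add_sub_assoc, this, sub_add_eq_add_sub, add_sub_assoc]

/-- The signed sum, over the lattice simplices with base point in `B`, of the determinants of the
images of their vertices under `L`. -/
noncomputable def volSum (B : Finset (Fin (n + 1) → ℤ))
    (L : (Fin (n + 1) → ℤ) → Fin (n + 1) → ℝ) : ℝ :=
  ∑ b ∈ B, ∑ π : Equiv.Perm (Fin (n + 1)), ((Equiv.Perm.sign π : ℤ) : ℝ) *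
    (of fun k => L (b + path π k)).det

/-- By `path_injective` at most one vertex of a simplex is `v`, so at most one row changes and the
determinant is affine in it. -/
theorem det_update_sub (L : (Fin (n + 1) → ℤ) → Fin (n + 1) → ℝ) (v : Fin (n + 1) → ℤ)
    (y : Fin (n + 1) → ℝ) (b : Fin (n + 1) → ℤ) (π : Equiv.Perm (Fin (n + 1))) :
    (of fun k => Function.update L v y (b + path π k)).det - (of fun k => L (b + path π k)).det =
      ∑ k, if b = v - path π k then
        (updateRow (of fun j => L (b + path π j)) k (y - L v)).det else 0 := by
  by_cases h : ∃ k, b = v - path π k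
  · obtain ⟨k, hk⟩ := h
    have hne : ∀ j, j ≠ k → b ≠ v - path π j := by
      intro j hj h
      rw [hk, sub_right_inj] at h
      exact hj (path_injective π h).symm
    rw [Finset.sum_eq_single k (fun j _ hj => if_neg (hne j hj)) (by simp), if_pos hk]
    have hv : b + path π k = v := by rw [hk]; abel
    have e1 : (of fun k => Function.update L v y (b + path π k)) =
        updateRow (of fun j => L (b + path π j)) k y := by
      ext i j
      by_cases hi : i = k
      · subst hi; simp [hv]
      · rw [updateRow_ne hi, of_apply, of_apply, Function.update_of_ne]
        intro h
        exact hne i hi (eq_sub_of_add_eq h)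
    have e2 : (of fun k => L (b + path π k)) =
        updateRow (of fun j => L (b + path π j)) k (L v) := by
      ext i j
      by_cases hi : i = k
      · subst hi; simp [hv]
      · rw [updateRow_ne hi]
    have e3 : y = (y - L v) + L v := by abel
    rw [e1]
    conv_lhs => rw [e3, det_updateRow_add]
    rw [← e2]
    ring
  · push Not at h
    rw [Finset.sum_eq_zero fun k _ => if_neg (h k), sub_eq_zero]
    congr 2
    ext k : 1
    rw [Function.update_of_ne]
    intro h'
    exact h k (eq_sub_of_add_eq h')

/-- The hypothesis `hv` puts the full star of `v` into the sum, so the changes, grouped by the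
position `k` of `v`, cancel by `sum_sign_det_star_eq_zero`. -/
theorem volSum_update {m : ℝ} (hm : m ≠ 0) {B : Finset (Fin (n + 1) → ℤ)}
    {L : (Fin (n + 1) → ℤ) → Fin (n + 1) → ℝ} (hL : ∀ x, ∑ i, L x i = m)
    {v : Fin (n + 1) → ℤ} {y : Fin (n + 1) → ℝ} (hy : ∑ i, y i = m)
    (hv : ∀ π k, v - path π k ∈ B) :
    volSum B (Function.update L v y) = volSum B L := by
  rw [← sub_eq_zero, volSum, volSum]
  simp only [← Finset.sum_sub_distrib, ← mul_sub, det_update_sub, Finset.mul_sum, mul_ite, mul_zero]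
  rw [Finset.sum_comm]
  simp_rw [Finset.sum_comm (s := B)]
  rw [Finset.sum_comm]
  refine Finset.sum_eq_zero fun k _ => ?_
  refine Eq.trans ?_ (sum_sign_det_star_eq_zero hm hL (δ := y - L v)
    (by simp [Finset.sum_sub_distrib, hy, hL]) v k)
  refine Finset.sum_congr rfl fun π _ => ?_
  rw [Finset.sum_eq_single (v - path π k) (fun b _ hb => if_neg hb)
    (fun h => absurd (hv π k) h), if_pos rfl]

theorem volSum_eq_of_eqOn_compl {m : ℝ} (hm : m ≠ 0) {B T : Finset (Fin (n + 1) → ℤ)}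
    (hT : ∀ v ∈ T, ∀ π k, v - path π k ∈ B)
    {L L' : (Fin (n + 1) → ℤ) → Fin (n + 1) → ℝ} (hL : ∀ x, ∑ i, L x i = m)
    (hL' : ∀ x, ∑ i, L' x i = m) (h : ∀ x ∉ T, L x = L' x) :
    volSum B L = volSum B L' := by
  induction T using Finset.induction_on generalizing L with
  | empty =>
    congr 1
    exact funext fun x => h x (Finset.notMem_empty x)
  | insert v T _ ih =>
    rw [← volSum_update hm hL (hL' v) (hT v (Finset.mem_insert_self v T))]
    refine ih (fun u hu => hT u (Finset.mem_insert_of_mem hu)) (fun x => ?_) fun x hx => ?_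
    · by_cases hxv : x = v
      · subst hxv; simpa using hL' x
      · rw [Function.update_of_ne hxv]; exact hL x
    · by_cases hxv : x = v
      · subst hxv; simp
      · rw [Function.update_of_ne hxv]
        exact h x (by simp [hxv, hx])

/-! ### The determinant of a lattice simplex -/

/-- The matrix whose rows are the steps. -/
def stepMatrix (n : ℕ) : Matrix (Fin (n + 1)) (Fin (n + 1)) ℝ := of fun a x => (step a x : ℝ)

theorem sum_stepMatrix (a : Fin (n + 1)) : ∑ x, stepMatrix n a x = 0 := by
  simpa [stepMatrix] using congrArg (fun z : ℤ => (z : ℝ)) (sum_step a)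

theorem det_stepMatrix : (stepMatrix n).det = 0 := by
  refine exists_mulVec_eq_zero_iff.1 ⟨1, one_ne_zero, ?_⟩
  ext a
  simpa [mulVec, dotProduct] using sum_stepMatrix a

/-- The only linear relation among the steps is that they sum to zero, up to scale. The Cramer
vector is such a relation, so the determinant does not depend on `r`. It vanishes when `b` has sum
zero, so it depends on `b` only through its sum. -/
theorem exists_det_stepMatrix_updateRow (n : ℕ) : ∃ κ : ℝ, κ ≠ 0 ∧
    ∀ (r : Fin (n + 1)) (b : Fin (n + 1) → ℝ),
      ((stepMatrix n).updateRow r b).det = (∑ x, b x) * κ := by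
  have hconst : ∀ b : Fin (n + 1) → ℝ, ∀ r,
      cramer (stepMatrix n)ᵀ b r = cramer (stepMatrix n)ᵀ b 0 := by
    intro b
    apply eq_zero_of_forall_add_one
    intro r
    have h := congrFun (mulVec_cramer (stepMatrix n)ᵀ b) (r + 1)
    rw [det_transpose, det_stepMatrix, zero_smul] at h
    have h2 : ((stepMatrix n)ᵀ *ᵥ cramer (stepMatrix n)ᵀ b) (r + 1) =
        cramer (stepMatrix n)ᵀ b r - cramer (stepMatrix n)ᵀ b (r + 1) := by
      simp [mulVec, dotProduct, stepMatrix, step_apply, sub_mul, Finset.sum_sub_distrib]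
    rw [h2] at h
    simp only [Pi.zero_apply] at h
    linarith
  have hzero : ∀ c : Fin (n + 1) → ℝ, ∑ x, c x = 0 → ∀ r, cramer (stepMatrix n)ᵀ c r = 0 := by
    intro c hc r
    rw [cramer_transpose_apply]
    refine exists_mulVec_eq_zero_iff.1 ⟨1, one_ne_zero, ?_⟩
    ext a
    by_cases ha : a = r
    · subst ha; simpa [mulVec, dotProduct] using hc
    · simpa [mulVec, dotProduct, updateRow_ne ha] using sum_stepMatrix a
  refine ⟨cramer (stepMatrix n)ᵀ (Pi.single 0 1) 0, ?_, fun r b => ?_⟩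
  · rw [← hconst _ (Fin.last n), cramer_transpose_apply]
    intro h
    obtain ⟨v, hv0, hv⟩ := exists_mulVec_eq_zero_iff.2 h
    apply hv0
    have h0 : v 0 = 0 := by
      simpa [mulVec, dotProduct, Pi.single_apply] using congrFun hv (Fin.last n)
    ext x
    induction x using Fin.induction with
    | zero => exact h0
    | succ i ih =>
      have h1 := congrFun hv i.castSucc
      have hne : i.castSucc ≠ Fin.last n := (Fin.castSucc_lt_last i).ne
      have h2 : v (i.castSucc + 1) - v i.castSucc = 0 := by
        simpa [mulVec, dotProduct, updateRow_ne hne, stepMatrix, step_apply, sub_mul,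
          Finset.sum_sub_distrib, sub_eq_iff_eq_add] using h1
      rw [Fin.coeSucc_eq_succ] at h2
      rw [sub_eq_zero.1 h2, ih, Pi.zero_apply, Pi.zero_apply]
  · rw [← cramer_transpose_apply]
    have e : b = (∑ x, b x) • Pi.single 0 1 + (b - (∑ x, b x) • Pi.single 0 1) := by abel
    conv_lhs => rw [e]
    rw [map_add, map_smul, Pi.add_apply, hzero _ _ r, add_zero, Pi.smul_apply, hconst, smul_eq_mul]
    simp [Finset.sum_sub_distrib, ← Finset.mul_sum]

theorem path_zero (π : Equiv.Perm (Fin (n + 1))) : path π 0 = 0 := by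
  funext x
  simp [path_apply]

theorem path_succ (π : Equiv.Perm (Fin (n + 1))) (i : Fin n) :
    path π i.succ = path π i.castSucc + step (π i.castSucc) := by
  have : Finset.Iio i.succ = insert i.castSucc (Finset.Iio i.castSucc) := by
    ext j
    simp only [Finset.mem_Iio, Finset.mem_insert, Fin.lt_def, Fin.ext_iff, Fin.val_succ,
      Fin.val_castSucc]
    omega
  simp only [path]
  rw [this, Finset.sum_insert (by simp)]
  exact add_comm _ _

/-- Subtracting consecutive rows leaves `b` and all steps except the last one, `step (π (Fin.last
n))`. Up to a row permutation this is `stepMatrix` with one row replaced by `b`, and the sign of `π`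
cancels. -/
theorem exists_sign_mul_det (n : ℕ) : ∃ κ : ℝ, κ ≠ 0 ∧
    ∀ (b : Fin (n + 1) → ℤ) (π : Equiv.Perm (Fin (n + 1))),
      ((Equiv.Perm.sign π : ℤ) : ℝ) *
        (of fun k x => (((b + path π k) x : ℤ) : ℝ)).det = (∑ x, (b x : ℝ)) * κ := by
  obtain ⟨κ, hκ, h⟩ := exists_det_stepMatrix_updateRow n
  -- The row `b` comes first but replaces the last step, hence the cyclic shift by one.
  let ρ : Equiv.Perm (Fin (n + 1)) := Equiv.subRight 1
  refine ⟨((Equiv.Perm.sign ρ : ℤ) : ℝ) * κ, mul_ne_zero ?_ hκ, fun b π => ?_⟩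
  · exact_mod_cast (Equiv.Perm.sign ρ).ne_zero
  have h1 : (of fun k x => (((b + path π k) x : ℤ) : ℝ)).det =
      (((stepMatrix n).updateRow (π (Fin.last n)) fun x => (b x : ℝ)).submatrix (π * ρ) id).det := by
    refine det_eq_of_forall_row_eq_smul_add_pred 1 (fun j => ?_) fun i j => ?_
    · have : ρ 0 = Fin.last n := by
        rw [Equiv.subRight_apply, zero_sub]
        rw [neg_eq_iff_add_eq_zero]
        exact (add_comm _ _).trans (Fin.last_add_one n)
      simp [path_zero, this]
    · have h2 : ρ i.succ = i.castSucc := by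
        rw [Equiv.subRight_apply, ← Fin.coeSucc_eq_succ, add_sub_cancel_right]
      have h3 : π i.castSucc ≠ π (Fin.last n) := fun e =>
        (Fin.castSucc_lt_last i).ne (π.injective e)
      rw [submatrix_apply, Equiv.Perm.mul_apply, h2, updateRow_ne h3, of_apply, of_apply,
        path_succ]
      simp [stepMatrix]
      ring
  rw [h1, det_permute, h, Equiv.Perm.sign_mul]
  have h4 : ((Equiv.Perm.sign π : ℤ) : ℝ) * ((Equiv.Perm.sign π : ℤ) : ℝ) = 1 := by
    exact_mod_cast Int.units_coe_mul_self _
  push_cast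
  linear_combination ((∑ x, (b x : ℝ)) * κ * ((Equiv.Perm.sign ρ : ℤ) : ℝ)) * h4

/-! ### Sperner's lemma by comparing volumes -/

theorem sum_add_path (b : Fin (n + 1) → ℤ) (π : Equiv.Perm (Fin (n + 1))) (k : Fin (n + 1)) :
    ∑ i, (b + path π k) i = ∑ i, b i := by
  simp [Finset.sum_add_distrib, sum_path]

theorem abs_path_le (π : Equiv.Perm (Fin (n + 1))) (k x : Fin (n + 1)) : |path π k x| ≤ 1 := by
  simpa [path_zero] using abs_path_sub_le π k 0 x

theorem exists_ne_zero_of_det_ne_zero {L : (Fin (n + 1) → ℤ) → Fin (n + 1) → ℝ}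
    {b : Fin (n + 1) → ℤ} {π : Equiv.Perm (Fin (n + 1))}
    (h : (of fun k => L (b + path π k)).det ≠ 0) (i : Fin (n + 1)) :
    ∃ k, L (b + path π k) i ≠ 0 := by
  by_contra hc
  push Not at hc
  exact h (det_eq_zero_of_column_eq_zero i hc)

/-- No column vanishes, so each coordinate is at least 1 at some vertex; it varies by at most 1 over
the simplex. -/
theorem nonneg_of_det_ne_zero {L : (Fin (n + 1) → ℤ) → Fin (n + 1) → ℝ} {b : Fin (n + 1) → ℤ}
    (hL : ∀ x : Fin (n + 1) → ℤ, ∑ i, x i = ∑ i, b i → ∀ i, L x i ≠ 0 → 0 < x i)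
    {π : Equiv.Perm (Fin (n + 1))} (h : (of fun k => L (b + path π k)).det ≠ 0)
    (k i : Fin (n + 1)) : 0 ≤ (b + path π k) i := by
  obtain ⟨j, hj⟩ := exists_ne_zero_of_det_ne_zero h i
  have h1 := hL _ (sum_add_path b π j) i hj
  have h2 := abs_le.1 (abs_path_sub_le π k j i)
  simp only [Pi.add_apply] at h1 ⊢
  linarith [h2.1]

/-- **Sperner's lemma** for the lattice points of a dilated standard simplex. -/
theorem exists_rainbow (n K : ℕ) (hK : 0 < K) (l : (Fin (n + 1) → ℤ) → Fin (n + 1))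
    (hl : ∀ x : Fin (n + 1) → ℤ, (∀ i, 0 ≤ x i) → ∑ i, x i = (n + 1) * K → 0 < x (l x)) :
    ∃ v : Fin (n + 1) → Fin (n + 1) → ℤ,
      (∀ i, (∀ x, 0 ≤ v i x) ∧ ∑ x, v i x = (n + 1) * K ∧ l (v i) = i) ∧
      ∀ i j x, |v i x - v j x| ≤ 1 := by
  classical
  obtain ⟨m, hm⟩ : ∃ m : ℤ, m = (n + 1) * K := ⟨_, rfl⟩
  have hm0 : 0 < m := by rw [hm]; positivity
  have hmR : (m : ℝ) ≠ 0 := by exact_mod_cast hm0.ne'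
  rw [← hm] at hl ⊢
  -- The labelling is extended to the whole hyperplane, still choosing a positive coordinate, so
  -- that simplices leaving the dilated simplex contribute nothing.
  have hex : ∀ x : Fin (n + 1) → ℤ, ∃ i, (∑ i, x i = m → 0 < x i) ∧
      ((∀ i, 0 ≤ x i) → ∑ i, x i = m → i = l x) := by
    intro x
    by_cases hx : ∑ i, x i = m
    · by_cases hx0 : ∀ i, 0 ≤ x i
      · exact ⟨l x, fun _ => hl x hx0 hx, fun _ _ => rfl⟩
      · obtain ⟨i, -, hi⟩ := Finset.exists_lt_of_sum_lt (s := Finset.univ)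
          (f := fun _ => (0 : ℤ)) (g := x) (by simp [hx, hm0])
        exact ⟨i, fun _ => hi, fun h => absurd h hx0⟩
    · exact ⟨0, fun h => absurd h hx, fun _ h => absurd h hx⟩
  choose l' hl'pos hl'eq using hex
  -- The margin of 1 on either side makes room for the base of every simplex that meets `T`.
  let B : Finset (Fin (n + 1) → ℤ) :=
    (Fintype.piFinset fun _ => Finset.Icc (-1) (m + 1)).filter fun x => ∑ i, x i = m
  let T : Finset (Fin (n + 1) → ℤ) := B.filter fun x => ∀ i, 0 ≤ x i
  let L₁ : (Fin (n + 1) → ℤ) → Fin (n + 1) → ℝ := fun x => Pi.single (l' x) (m : ℝ)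
  let L₀ : (Fin (n + 1) → ℤ) → Fin (n + 1) → ℝ := fun x => if x ∈ T then fun i => (x i : ℝ) else L₁ x
  have hle : ∀ x : Fin (n + 1) → ℤ, (∀ i, 0 ≤ x i) → ∑ i, x i = m → ∀ i, x i ≤ m := by
    intro x h0 hs i
    rw [← hs]
    exact Finset.single_le_sum (fun j _ => h0 j) (Finset.mem_univ i)
  have hT : ∀ x, x ∈ T ↔ (∀ i, 0 ≤ x i) ∧ ∑ i, x i = m := by
    intro x
    simp only [T, B, Finset.mem_filter, Fintype.mem_piFinset, Finset.mem_Icc]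
    refine ⟨fun h => ⟨h.2, h.1.2⟩, fun h => ⟨⟨fun i => ⟨?_, ?_⟩, h.2⟩, h.1⟩⟩
    · linarith [h.1 i]
    · linarith [hle x h.1 h.2 i]
  have hTB : ∀ v ∈ T, ∀ π k, v - path π k ∈ B := by
    intro v hv π k
    obtain ⟨h0, hs⟩ := (hT v).1 hv
    simp only [B, Finset.mem_filter, Fintype.mem_piFinset, Finset.mem_Icc, Pi.sub_apply,
      Finset.sum_sub_distrib, sum_path, sub_zero]
    refine ⟨fun i => ?_, hs⟩
    have h1 := abs_le.1 (abs_path_le π k i)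
    have h2 := h0 i
    have h3 := hle v h0 hs i
    constructor <;> linarith [h1.1, h1.2]
  have hsum₁ : ∀ x, ∑ i, L₁ x i = m := fun x => by simp [L₁]
  have hsum₀ : ∀ x, ∑ i, L₀ x i = m := by
    intro x
    by_cases hx : x ∈ T
    · simp only [L₀, hx, if_true]
      exact_mod_cast ((hT x).1 hx).2
    · simp only [L₀, hx, if_false]
      exact hsum₁ x
  have hpos₁ : ∀ x : Fin (n + 1) → ℤ, ∑ i, x i = m → ∀ i, L₁ x i ≠ 0 → 0 < x i := by
    intro x hx i hi
    have : i = l' x := by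
      by_contra h
      exact hi (Pi.single_eq_of_ne h _)
    rw [this]
    exact hl'pos x hx
  have hpos₀ : ∀ x : Fin (n + 1) → ℤ, ∑ i, x i = m → ∀ i, L₀ x i ≠ 0 → 0 < x i := by
    intro x hx i
    by_cases hxT : x ∈ T
    · simp only [L₀, hxT, if_true]
      intro h
      exact lt_of_le_of_ne (((hT x).1 hxT).1 i) fun h' => h (by simp [← h'])
    · simp only [L₀, hxT, if_false]
      exact hpos₁ x hx i
  have hB : ∀ b ∈ B, ∑ i, b i = m := fun b hb => (Finset.mem_filter.1 hb).2
  have heq : volSum B L₁ = volSum B L₀ :=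
    volSum_eq_of_eqOn_compl hmR hTB hsum₁ hsum₀ fun x hx => by simp [L₀, hx]
  obtain ⟨κ, hκ, hdet⟩ := exists_sign_mul_det n
  -- For the identity on `T`, each simplex inside `T` contributes the same nonzero amount and all
  -- others contribute 0, so nothing can cancel.
  have hval : ∀ b ∈ B, ∀ π, ((Equiv.Perm.sign π : ℤ) : ℝ) * (of fun k => L₀ (b + path π k)).det =
      if ∀ k, b + path π k ∈ T then m * κ else 0 := by
    intro b hb π
    split_ifs with h
    · have hb' : ∑ x, (b x : ℝ) = m := by exact_mod_cast hB b hb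
      rw [← hb', ← hdet b π]
      congr 2
      ext k x
      simp [L₀, h k]
    · by_contra hne
      apply h
      intro k
      refine (hT _).2 ⟨nonneg_of_det_ne_zero (fun x hx => hpos₀ x (hx.trans (hB b hb)))
        (right_ne_zero_of_mul hne) k, (sum_add_path b π k).trans (hB b hb)⟩
  have hvol : volSum B L₀ = (∑ b ∈ B, ∑ π : Equiv.Perm (Fin (n + 1)),
      if ∀ k, b + path π k ∈ T then (1 : ℝ) else 0) * (m * κ) := by
    simp only [volSum, Finset.sum_mul, ite_mul, one_mul, zero_mul]
    exact Finset.sum_congr rfl fun b hb => Finset.sum_congr rfl fun π _ => hval b hb π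
  have hne : volSum B L₁ ≠ 0 := by
    rw [heq, hvol]
    refine mul_ne_zero (ne_of_gt ?_) (mul_ne_zero hmR hκ)
    have hnn : ∀ b π, (0 : ℝ) ≤ if ∀ k, b + path π k ∈ T then 1 else 0 := fun b π => by
      split_ifs <;> norm_num
    -- The factor `n + 1` in the dilation makes the barycentre `(K, …, K)` a lattice point, and `K ≥
    -- 1` keeps a simplex based there inside `T`.
    have hc : ∀ k, (fun _ => (K : ℤ)) + path (1 : Equiv.Perm (Fin (n + 1))) k ∈ T := by
      intro k
      refine (hT _).2 ⟨fun i => ?_, ?_⟩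
      · have := (abs_le.1 (abs_path_le (1 : Equiv.Perm (Fin (n + 1))) k i)).1
        simp only [Pi.add_apply]
        omega
      · rw [sum_add_path, hm]
        simp
    have hcB : (fun _ => (K : ℤ)) ∈ B := by
      have := hc 0
      rw [path_zero, add_zero] at this
      exact (Finset.mem_filter.1 this).1
    refine Finset.sum_pos' (fun b _ => Finset.sum_nonneg fun π _ => hnn b π) ⟨_, hcB, ?_⟩
    refine Finset.sum_pos' (fun π _ => hnn _ π) ⟨1, Finset.mem_univ _, ?_⟩
    rw [if_pos hc]
    norm_num
  obtain ⟨b, hb, hb'⟩ := Finset.exists_ne_zero_of_sum_ne_zero hne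
  obtain ⟨π, -, hπ⟩ := Finset.exists_ne_zero_of_sum_ne_zero hb'
  have hd := right_ne_zero_of_mul hπ
  have hin := nonneg_of_det_ne_zero (fun x hx => hpos₁ x (hx.trans (hB b hb))) hd
  have hS := fun k => (sum_add_path b π k).trans (hB b hb)
  choose k hk using exists_ne_zero_of_det_ne_zero hd
  refine ⟨fun i => b + path π (k i), fun i => ⟨hin (k i), hS (k i), ?_⟩, fun i j x => ?_⟩
  · rw [← hl'eq _ (hin (k i)) (hS (k i))]
    by_contra h
    exact hk i (Pi.single_eq_of_ne (Ne.symm h) _)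
  · simpa using abs_path_sub_le π (k i) (k j) x

end CyclicLattice

/-! ### Face-preserving self-maps of the simplex -/

open Filter Topology in
/-- A continuous self-map of the standard simplex that maps every face into itself is onto. -/
theorem stdSimplex_surjective_of_mapsTo_faces {n : ℕ}
    {h : stdSimplex ℝ (Fin (n + 1)) → stdSimplex ℝ (Fin (n + 1))} (hc : Continuous h)
    (hface : ∀ x i, x.1 i = 0 → (h x).1 i = 0) : Function.Surjective h := by
  intro y
  -- This supplies the Sperner label. If it failed, `h p` would be at most `y` in every coordinate
  -- and strictly smaller in one, although both sum to 1.
  have hex : ∀ p : stdSimplex ℝ (Fin (n + 1)), ∃ i, 0 < p.1 i ∧ y.1 i ≤ (h p).1 i := by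
    intro p
    by_contra! hcon
    have h1 : ∀ i, (h p).1 i ≤ y.1 i := by
      intro i
      rcases (p.2.1 i).eq_or_lt with hi | hi
      · rw [hface p i hi.symm]; exact y.2.1 i
      · exact (hcon i hi).le
    obtain ⟨i, -, hi⟩ := Finset.exists_lt_of_sum_lt (s := Finset.univ)
      (f := fun _ => (0 : ℝ)) (g := p.1) (by simp [p.2.2])
    have h2 := Finset.sum_lt_sum (fun i _ => h1 i) ⟨i, Finset.mem_univ i, hcon i hi⟩
    rw [(h p).2.2, y.2.2] at h2
    exact lt_irrefl _ h2
  choose c hcpos hcle using hex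
  have hstep : ∀ K : ℕ, ∃ p : Fin (n + 1) → stdSimplex ℝ (Fin (n + 1)),
      (∀ i, c (p i) = i) ∧ ∀ i j x, |(p i).1 x - (p j).1 x| ≤ 1 / ((K : ℝ) + 1) := by
    intro K
    have hM : (0 : ℝ) < (n + 1) * ((K + 1 : ℕ) : ℝ) := by positivity
    have hmem : ∀ x : Fin (n + 1) → ℤ, (∀ i, 0 ≤ x i) ∧ ∑ i, x i = (n + 1) * ((K + 1 : ℕ) : ℤ) →
        (fun i => (x i : ℝ) / ((n + 1) * ((K + 1 : ℕ) : ℝ))) ∈ stdSimplex ℝ (Fin (n + 1)) := by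
      intro x hx
      refine ⟨fun i => div_nonneg (by exact_mod_cast hx.1 i) hM.le, ?_⟩
      rw [← Finset.sum_div, div_eq_one_iff_eq hM.ne']
      exact_mod_cast hx.2
    classical
    let l : (Fin (n + 1) → ℤ) → Fin (n + 1) := fun x =>
      if hx : (∀ i, 0 ≤ x i) ∧ ∑ i, x i = (n + 1) * ((K + 1 : ℕ) : ℤ) then c ⟨_, hmem x hx⟩ else 0
    obtain ⟨v, hv, hv'⟩ := CyclicLattice.exists_rainbow n (K + 1) K.succ_pos l (by
      intro x h0 hs
      simp only [l, dif_pos (And.intro h0 hs)]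
      have := hcpos ⟨_, hmem x ⟨h0, hs⟩⟩
      exact_mod_cast (div_pos_iff_of_pos_right hM).1 this)
    refine ⟨fun i => ⟨_, hmem (v i) ⟨(hv i).1, (hv i).2.1⟩⟩, fun i => ?_, fun i j x => ?_⟩
    · have := (hv i).2.2
      simp only [l] at this
      rwa [dif_pos ⟨(hv i).1, (hv i).2.1⟩] at this
    · simp only
      rw [← sub_div, abs_div, abs_of_pos hM]
      have h1 : |(v i x : ℝ) - v j x| ≤ 1 := by exact_mod_cast hv' i j x
      refine div_le_div₀ zero_le_one h1 (by positivity) ?_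
      push_cast
      nlinarith [Nat.cast_nonneg (α := ℝ) n, Nat.cast_nonneg (α := ℝ) K]
  choose p hp hp' using hstep
  have : CompactSpace (stdSimplex ℝ (Fin (n + 1))) :=
    isCompact_iff_compactSpace.1 (isCompact_stdSimplex ℝ (Fin (n + 1)))
  obtain ⟨q, φ, hφ, hq⟩ := CompactSpace.tendsto_subseq fun K => p K 0
  have hlim : ∀ i, Tendsto (fun K => p (φ K) i) atTop (𝓝 q) := by
    intro i
    rw [tendsto_subtype_rng, tendsto_pi_nhds] at hq ⊢
    intro x
    have h0 : Tendsto (fun K => (p (φ K) i).1 x - (p (φ K) 0).1 x) atTop (𝓝 0) :=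
      squeeze_zero_norm (fun K => hp' (φ K) i 0 x)
        (tendsto_one_div_add_atTop_nhds_zero_nat.comp hφ.tendsto_atTop)
    simpa using h0.add (hq x)
  -- The vertices labelled `i` also converge to `q`, so every label's inequality survives at `q`;
  -- equal coordinate sums then force `h q = y`.
  have hle : ∀ i, y.1 i ≤ (h q).1 i := by
    intro i
    have h1 : Tendsto (fun K => (h (p (φ K) i)).1 i) atTop (𝓝 ((h q).1 i)) :=
      (((continuous_apply i).comp (continuous_subtype_val.comp hc)).tendsto q).comp (hlim i)
    refine ge_of_tendsto' h1 fun K => ?_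
    have := hcle (p (φ K) i)
    rwa [hp] at this
  refine ⟨q, Subtype.ext (funext fun i => ?_)⟩
  have h1 := (Finset.sum_eq_sum_iff_of_le fun i _ => hle i).1 (y.2.2.trans (h q).2.2.symm)
  exact (h1 i (Finset.mem_univ i)).symm

/-! ### Weights of nested sequences -/

namespace NestedSeq

variable {n : ℕ}

noncomputable instance : Fintype (NestedSeq n) :=
  haveI : Finite (NestedSeq n) := Finite.of_injective NestedSeq.sets fun _ _ h => NestedSeq.ext h
  Fintype.ofFinite _

/-- The nested sequence with one member. -/
def single (J : Finset (Fin (n + 1))) (h0 : J ≠ ∅) (h1 : J ≠ Finset.univ) : NestedSeq n where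
  sets := {J}
  nonempty := Finset.singleton_nonempty J
  chain := by simp
  ne_empty := by simpa using h0
  ne_univ := by simpa using h1

theorem largest_single (J : Finset (Fin (n + 1))) (h0 : J ≠ ∅) (h1 : J ≠ Finset.univ) :
    (single J h0 h1).largest = J := by
  simp [largest, single]

/-- A continuous function of `x`, positive if and only if all coordinates with indices in `J` are
smaller than all the other coordinates. -/
noncomputable def gap (x : Fin (n + 1) → ℝ) (J : Finset (Fin (n + 1))) : ℝ :=
  ∏ i ∈ J, ∏ j ∈ Jᶜ, max 0 (x j - x i)

theorem gap_pos {x : Fin (n + 1) → ℝ} {J : Finset (Fin (n + 1))}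
    (h : ∀ i ∈ J, ∀ j ∉ J, x i < x j) : 0 < gap x J :=
  Finset.prod_pos fun i hi => Finset.prod_pos fun j hj =>
    lt_max_of_lt_right (sub_pos.2 (h i hi j (Finset.mem_compl.1 hj)))

theorem lt_of_gap_pos {x : Fin (n + 1) → ℝ} {J : Finset (Fin (n + 1))} (h : 0 < gap x J)
    {i j : Fin (n + 1)} (hi : i ∈ J) (hj : j ∉ J) : x i < x j := by
  by_contra hc
  refine h.ne' (Finset.prod_eq_zero hi (Finset.prod_eq_zero (Finset.mem_compl.2 hj) ?_))
  exact max_eq_left (by linarith)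

/-- A continuous function of `x`, positive if and only if the gaps of `x` at the members of `I` are
larger than those at all the other nonempty proper subsets. -/
noncomputable def weight (x : Fin (n + 1) → ℝ) (I : NestedSeq n) : ℝ :=
  ∏ J ∈ I.sets, ∏ K with (K ≠ ∅ ∧ K ≠ Finset.univ) ∧ K ∉ I.sets, max 0 (gap x J - gap x K)

theorem weight_nonneg (x : Fin (n + 1) → ℝ) (I : NestedSeq n) : 0 ≤ weight x I :=
  Finset.prod_nonneg fun _ _ => Finset.prod_nonneg fun _ _ => le_max_left _ _

theorem weight_pos {x : Fin (n + 1) → ℝ} {I : NestedSeq n}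
    (h : ∀ J ∈ I.sets, ∀ K ∉ I.sets, K ≠ ∅ → K ≠ Finset.univ → gap x K < gap x J) :
    0 < weight x I := by
  refine Finset.prod_pos fun J hJ => Finset.prod_pos fun K hK => lt_max_of_lt_right (sub_pos.2 ?_)
  simp only [Finset.mem_filter, Finset.mem_univ, true_and] at hK
  exact h J hJ K hK.2 hK.1.1 hK.1.2

theorem mem_of_weight_ne_zero {x : Fin (n + 1) → ℝ} {I : NestedSeq n} (h : weight x I ≠ 0)
    {J : Finset (Fin (n + 1))} (h0 : J ≠ ∅) (h1 : J ≠ Finset.univ)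
    (hmax : ∀ K, K ≠ ∅ → K ≠ Finset.univ → gap x K ≤ gap x J) : J ∈ I.sets := by
  by_contra hJ
  obtain ⟨K, hK⟩ := I.nonempty
  refine h (Finset.prod_eq_zero hK (Finset.prod_eq_zero (i := J) (by simp [h0, h1, hJ]) ?_))
  exact max_eq_left (sub_nonpos.2 (hmax K (I.ne_empty K hK) (I.ne_univ K hK)))

theorem continuous_gap (J : Finset (Fin (n + 1))) :
    Continuous fun x : Fin (n + 1) → ℝ => gap x J := by
  unfold gap
  fun_prop

theorem continuous_weight (I : NestedSeq n) :
    Continuous fun x : Fin (n + 1) → ℝ => weight x I := by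
  have := continuous_gap (n := n)
  unfold weight
  fun_prop

section Boundary

variable {x : stdSimplex ℝ (Fin (n + 1))}

theorem exists_gap_pos (hx : ∃ i, x.1 i = 0) :
    ∃ J : Finset (Fin (n + 1)), J ≠ ∅ ∧ J ≠ Finset.univ ∧ 0 < gap x.1 J := by
  classical
  obtain ⟨i, hi⟩ := hx
  refine ⟨Finset.univ.filter fun i => x.1 i = 0, Finset.ne_empty_of_mem (a := i) (by simp [hi]),
    fun h => ?_, gap_pos fun i hi j hj => ?_⟩
  · have h0 : ∀ j, x.1 j = 0 := fun j =>
      (Finset.mem_filter.1 (h.symm.subset (Finset.mem_univ j))).2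
    have := x.2.2
    simp [h0] at this
  · simp only [Finset.mem_filter, Finset.mem_univ, true_and] at hi hj
    rw [hi]
    exact lt_of_le_of_ne (x.2.1 j) (Ne.symm hj)

theorem exists_weight_pos (hx : ∃ i, x.1 i = 0) : ∃ I : NestedSeq n, 0 < weight x.1 I := by
  classical
  obtain ⟨J, h0, h1, hJ⟩ := exists_gap_pos hx
  let C : Finset (Finset (Fin (n + 1))) :=
    Finset.univ.filter fun K => (K ≠ ∅ ∧ K ≠ Finset.univ) ∧ 0 < gap x.1 K
  have hC : ∀ K, K ∈ C ↔ (K ≠ ∅ ∧ K ≠ Finset.univ) ∧ 0 < gap x.1 K := by simp [C]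
  refine ⟨⟨C, ⟨J, (hC J).2 ⟨⟨h0, h1⟩, hJ⟩⟩, fun K hK L hL => ?_, fun K hK => ((hC K).1 hK).1.1,
    fun K hK => ((hC K).1 hK).1.2⟩, weight_pos fun K hK L hL hL0 hL1 => ?_⟩
  -- Incomparable sets with positive gaps would give `i`, `j` with both `x i < x j` and `x j < x i`.
  · by_contra! hcon
    obtain ⟨i, hi, hi'⟩ := Finset.not_subset.1 hcon.1
    obtain ⟨j, hj, hj'⟩ := Finset.not_subset.1 hcon.2
    exact lt_asymm (lt_of_gap_pos ((hC K).1 hK).2 hi hj') (lt_of_gap_pos ((hC L).1 hL).2 hj hi')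
  · refine lt_of_le_of_lt (not_lt.1 fun h => hL ((hC L).2 ⟨⟨hL0, hL1⟩, h⟩)) ((hC K).1 hK).2

/-- A set `J` of maximal gap works: nonzero weight excludes a nonmember of maximal gap. Its gap is
positive, so a zero coordinate outside `J` would exceed some coordinate of `x`, which is
nonnegative. -/
theorem exists_mem_of_weight_ne_zero (hx : ∃ i, x.1 i = 0) :
    ∃ J : Finset (Fin (n + 1)), J ≠ ∅ ∧ J ≠ Finset.univ ∧ (∀ i, x.1 i = 0 → i ∈ J) ∧
      ∀ I : NestedSeq n, weight x.1 I ≠ 0 → J ∈ I.sets := by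
  classical
  obtain ⟨J₀, h0, h1, hJ₀⟩ := exists_gap_pos hx
  obtain ⟨J, hJ, hmax⟩ := (Finset.univ.filter fun K : Finset (Fin (n + 1)) =>
    K ≠ ∅ ∧ K ≠ Finset.univ).exists_max_image (gap x.1) ⟨J₀, by simp [h0, h1]⟩
  simp only [Finset.mem_filter, Finset.mem_univ, true_and] at hJ hmax
  refine ⟨J, hJ.1, hJ.2, fun i hi => ?_, fun I hI =>
    mem_of_weight_ne_zero hI hJ.1 hJ.2 fun K hK0 hK1 => hmax K ⟨hK0, hK1⟩⟩
  by_contra hiJ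
  obtain ⟨j, hj⟩ := Finset.nonempty_iff_ne_empty.2 hJ.1
  have := lt_of_gap_pos (hJ₀.trans_le (hmax J₀ ⟨h0, h1⟩)) hj hiJ
  rw [hi] at this
  exact absurd (x.2.1 j) (not_le.2 this)

end Boundary

end NestedSeq

/-! ### From the simplex to the permutahedron -/

namespace Permutahedron

variable {n : ℕ} {E : Type*} [NormedAddCommGroup E] [NormedSpace ℝ E] (P : Permutahedron n E)

theorem convex_carrier : Convex ℝ P.carrier := by
  obtain ⟨s, -, hs⟩ := P.isPolytope
  rw [hs]
  exact convex_convexHull ℝ s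

theorem convex_face (I : NestedSeq n) : Convex ℝ (P.face I) :=
  (P.labelling I).2.1.convex P.convex_carrier

theorem face_nonempty (I : NestedSeq n) : (P.face I).Nonempty := (P.labelling I).2.2.1

theorem face_subset (I : NestedSeq n) : P.face I ⊆ P.carrier := (P.labelling I).2.1.subset

theorem face_mono {I J : NestedSeq n} (h : I ≤ J) : P.face I ⊆ P.face J :=
  P.labelling.monotone h

/-- There is a continuous map from the simplex to the permutahedron which maps each point `x` of the
boundary into a face whose label has a member containing all the `i` with `x i = 0`. -/
theorem exists_continuous_from_stdSimplex :
    ∃ g : stdSimplex ℝ (Fin (n + 1)) → P.carrier, Continuous g ∧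
      ∀ x, (∃ i, x.1 i = 0) → ∃ I : NestedSeq n, (g x : E) ∈ P.face I ∧
        ∀ i, x.1 i = 0 → i ∈ I.largest := by
  obtain ⟨p, hp⟩ := P.nonempty
  choose b hb using P.face_nonempty
  -- The extra index `none` keeps the total weight positive in the interior, and its weight vanishes
  -- on the boundary.
  let w : stdSimplex ℝ (Fin (n + 1)) → Option (NestedSeq n) → ℝ := fun x o =>
    o.elim (∏ i, x.1 i) (NestedSeq.weight x.1)
  let z : Option (NestedSeq n) → E := fun o => o.elim p b
  have hw : ∀ x o, 0 ≤ w x o := by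
    rintro x (_ | I)
    · exact Finset.prod_nonneg fun i _ => x.2.1 i
    · exact NestedSeq.weight_nonneg _ I
  have hsum : ∀ x, 0 < ∑ o, w x o := by
    intro x
    by_cases hx : ∃ i, x.1 i = 0
    · obtain ⟨I, hI⟩ := NestedSeq.exists_weight_pos hx
      exact Finset.sum_pos' (fun o _ => hw x o) ⟨some I, Finset.mem_univ _, hI⟩
    · push Not at hx
      exact Finset.sum_pos' (fun o _ => hw x o) ⟨none, Finset.mem_univ _,
        Finset.prod_pos fun i _ => lt_of_le_of_ne (x.2.1 i) (hx i).symm⟩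
  have hwc : ∀ o, Continuous fun x => w x o := by
    rintro (_ | I)
    · exact continuous_finsetProd _ fun i _ => (continuous_apply i).comp continuous_subtype_val
    · exact (NestedSeq.continuous_weight I).comp continuous_subtype_val
  have hz : ∀ o, z o ∈ P.carrier := by
    rintro (_ | I)
    · exact hp
    · exact P.face_subset I (hb I)
  refine ⟨fun x => ⟨Finset.univ.centerMass (w x) z, P.convex_carrier.centerMass_mem
    (fun o _ => hw x o) (hsum x) fun o _ => hz o⟩, ?_, fun x hx => ?_⟩
  · refine Continuous.subtype_mk ?_ _
    unfold Finset.centerMass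
    exact ((continuous_finsetSum _ fun o _ => hwc o).inv₀ fun x => (hsum x).ne').smul
      (continuous_finsetSum _ fun o _ => (hwc o).smul continuous_const)
  · classical
    obtain ⟨J, h0, h1, hZ, hJ⟩ := NestedSeq.exists_mem_of_weight_ne_zero hx
    refine ⟨NestedSeq.single J h0 h1, ?_, by simpa only [NestedSeq.largest_single] using hZ⟩
    simp only
    rw [← Finset.centerMass_filter_ne_zero]
    refine (P.convex_face _).centerMass_mem (fun o _ => hw x o) ?_ ?_
    · rw [Finset.sum_filter_ne_zero]
      exact hsum x
    · rintro (_ | I) ho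
      · obtain ⟨i, hi⟩ := hx
        exact absurd (Finset.prod_eq_zero (Finset.mem_univ i) hi) (Finset.mem_filter.1 ho).2
      · refine P.face_mono (I := I) ?_ (hb I)
        exact Finset.singleton_subset_iff.2 (hJ I (Finset.mem_filter.1 ho).2)

end Permutahedron

/-! ### Barycentric coordinates -/

section Simplex

variable {n : ℕ} {V : Type*} [NormedAddCommGroup V] [NormedSpace ℝ V] (s : Affine.Simplex ℝ V n)

theorem image_stdSimplex_eq_simplexBody :
    Fintype.linearCombination ℝ s.points '' stdSimplex ℝ (Fin (n + 1)) = simplexBody s := by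
  classical
  rw [← convexHull_rangle_single_eq_stdSimplex, LinearMap.image_convexHull, simplexBody,
    ← Set.range_comp]
  congr 2
  ext i
  simp

/-- Barycentric coordinates on a simplex, as a homeomorphism. -/
theorem exists_homeomorph_stdSimplex_simplexBody :
    ∃ e : stdSimplex ℝ (Fin (n + 1)) ≃ₜ simplexBody s,
      ∀ x, (e x : V) = Fintype.linearCombination ℝ s.points x.1 := by
  let e : stdSimplex ℝ (Fin (n + 1)) → simplexBody s := fun x =>
    ⟨Fintype.linearCombination ℝ s.points x.1,
      image_stdSimplex_eq_simplexBody s ▸ Set.mem_image_of_mem _ x.2⟩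
  have hinj : Function.Injective e := by
    intro x y h
    have h1 : Fintype.linearCombination ℝ s.points x.1 = Fintype.linearCombination ℝ s.points y.1 :=
      congrArg Subtype.val h
    have h2 := affineIndependent_iff.1 s.independent Finset.univ (x.1 - y.1)
      (by simp [Finset.sum_sub_distrib, x.2.2, y.2.2])
      (by rw [← Fintype.linearCombination_apply, map_sub, h1, sub_self])
    exact Subtype.ext (funext fun i => sub_eq_zero.1 (h2 i (Finset.mem_univ i)))
  have hsurj : Function.Surjective e := by
    rintro ⟨v, hv⟩
    obtain ⟨x, hx, rfl⟩ := (image_stdSimplex_eq_simplexBody s).symm ▸ hv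
    exact ⟨⟨x, hx⟩, rfl⟩
  have hcont : Continuous e := by
    refine Continuous.subtype_mk ?_ _
    exact (LinearMap.continuous_of_finiteDimensional _).comp continuous_subtype_val
  have : CompactSpace (stdSimplex ℝ (Fin (n + 1))) :=
    isCompact_iff_compactSpace.1 (isCompact_stdSimplex ℝ (Fin (n + 1)))
  exact ⟨Continuous.homeoOfEquivCompactToT2 (f := Equiv.ofBijective e ⟨hinj, hsurj⟩) hcont,
    fun _ => rfl⟩

theorem exists_of_mem_simplexFace {I : Finset (Fin (n + 1))} {v : V} (hv : v ∈ simplexFace s I) :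
    ∃ x : stdSimplex ℝ (Fin (n + 1)), Fintype.linearCombination ℝ s.points x.1 = v ∧
      ∀ i ∈ I, x.1 i = 0 := by
  classical
  have h1 : simplexFace s I =
      Fintype.linearCombination ℝ s.points '' convexHull ℝ ((Pi.single · (1 : ℝ)) '' {i | i ∉ I}) := by
    rw [LinearMap.image_convexHull, simplexFace, Set.image_image]
    simp
  rw [h1] at hv
  obtain ⟨x, hx, rfl⟩ := hv
  have hconv : Convex ℝ {x : Fin (n + 1) → ℝ | ∀ i ∈ I, x i = 0} := by
    intro x hx y hy a b _ _ _ i hi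
    simp [hx i hi, hy i hi]
  have hx' : x ∈ stdSimplex ℝ (Fin (n + 1)) ∩ {x | ∀ i ∈ I, x i = 0} := by
    refine convexHull_min ?_ ((convex_stdSimplex ℝ _).inter hconv) hx
    rintro _ ⟨j, hj, rfl⟩
    exact ⟨single_mem_stdSimplex ℝ j, fun i hi => Pi.single_eq_of_ne (ne_of_mem_of_not_mem hi hj) _⟩
  exact ⟨⟨x, hx'.1⟩, rfl, hx'.2⟩

end Simplex

/-! ### Surjectivity of `f` -/

theorem mainTheorem7 (n : ℕ)
    {E : Type*} [NormedAddCommGroup E] [NormedSpace ℝ E] (P : Permutahedron n E)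
    {V : Type*} [NormedAddCommGroup V] [NormedSpace ℝ V] (s : Affine.Simplex ℝ V n)
    (f : P.carrier → simplexBody s) (hf : Continuous f)
    (hface : ∀ (I : NestedSeq n) (x : P.carrier),
      (x : E) ∈ P.face I → (f x : V) ∈ simplexFace s I.largest) :
    Function.Surjective f := by
  obtain ⟨g, hg, hgface⟩ := P.exists_continuous_from_stdSimplex
  obtain ⟨e, he⟩ := exists_homeomorph_stdSimplex_simplexBody s
  have hsurj : Function.Surjective fun x => e.symm (f (g x)) := by
    refine stdSimplex_surjective_of_mapsTo_faces (e.symm.continuous.comp (hf.comp hg))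
      fun x i hi => ?_
    obtain ⟨I, hI, hZ⟩ := hgface x ⟨i, hi⟩
    obtain ⟨y, hy, hy0⟩ := exists_of_mem_simplexFace s (hface I (g x) hI)
    have : e y = f (g x) := Subtype.ext ((he y).trans hy)
    rw [← this, e.symm_apply_apply]
    exact hy0 i (hZ i hi)
  intro y
  obtain ⟨x, hx⟩ := hsurj (e.symm y)
  exact ⟨g x, e.symm.injective hx⟩
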